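/- Let $R$ be a commutative Noetherian local ring with maximal ideal $\mathfrak m$, and let $M$ be a finitely generated $R$-module of (Krull) dimension $d \ge 1$. Let $N \subseteq M$ be a submodule with $\operatorname{depth}(M/N) \ge d-1$ (where the zero module has depth $\infty$). Then for every ideal $\mathfrak q$ of $R$ generated by a system of parameters on $M$, i.e. by $d$ elements $x_1,\dots,x_d \in \mathfrak m$ such that $M/(x_1,\dots,x_d)M$ has finite length, one has $$\ell(N/\mathfrak q N) \le \ell(M/\mathfrak q M),$$ where $\ell$ denotes the length of an $R$-module. -/

import Mathlib

open IsLocalRing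

section

variable {R : Type*} [CommRing R] [IsLocalRing R] (M : Type*) [AddCommGroup M] [Module R M]

/-- A finite sequence `x` in a local ring `R` is a system of parameters on the `R`-module `M` if
it consists of exactly `dim M` elements of the maximal ideal and `M / (x) M` has finite length. -/
structure IsSystemOfParameters {n : ℕ} (x : Fin n → R) : Prop where
  mem_maximalIdeal : ∀ i, x i ∈ maximalIdeal R
  supportDim_eq : Module.supportDim R M = n
  isFiniteLength : IsFiniteLength R (M ⧸ (Ideal.span (Set.range x) • ⊤ : Submodule R M))

variable (R) in
open scoped Classical in
/-- The depth of a module `M` over a local ring `(R, 𝔪)`: the supremum of the lengths of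
`M`-regular sequences in `𝔪`, with the usual convention that it is `∞` if `𝔪 M = M`
(for finitely generated `M` over a Noetherian ring, this means `M = 0`). -/
noncomputable def moduleDepth : ℕ∞ :=
  if (maximalIdeal R • ⊤ : Submodule R M) = ⊤ then ⊤
  else ⨆ rs : {rs : List R // (∀ r ∈ rs, r ∈ maximalIdeal R) ∧
    RingTheory.Sequence.IsRegular M rs}, (rs.1.length : ℕ∞)

end

open Function RingTheory.Sequence
open scoped Pointwise

/-! ### Length inequalities and the one-parameter case. -/

section Length

variable {R : Type*} [CommRing R] {M N P : Type*} [AddCommGroup M] [AddCommGroup N]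
  [AddCommGroup P] [Module R M] [Module R N] [Module R P]

/-! Put `P = M/N` and induct on `d`. For `d = 1` nothing is needed of the depth: the snake lemma for
multiplication by `x` makes the kernel of `N/xN → M/xM` a quotient of the kernel of `x` on `P`, and
that kernel is at most as long as `P/xP`, the cokernel of `N/xN → M/xM`
(`Module.End.length_ker_le_length_quotient_range`). For `d > 1`, prime avoidance gives a minimal
generator `y` of `q` that is regular on `P`. Reduction modulo `y` then keeps `0 → N → M → P → 0`
exact, leaves `d - 1` generators, and lowers the depth of `P` by at most one
(`HasWeaklyRegularSeq.quotSMulTop`). -/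

theorem LinearMap.length_eq_ker_add_range (f : M →ₗ[R] N) :
    Module.length R M = Module.length R (ker f) + Module.length R (range f) :=
  Module.length_eq_add_of_exact (ker f).subtype f.rangeRestrict (Submodule.subtype_injective _)
    f.surjective_rangeRestrict (by
      rw [LinearMap.exact_iff, Submodule.range_subtype, LinearMap.ker_rangeRestrict])

theorem Submodule.length_eq_add_quotient (S : Submodule R M) :
    Module.length R M = Module.length R S + Module.length R (M ⧸ S) :=
  Module.length_eq_add_of_exact S.subtype S.mkQ S.subtype_injective S.mkQ_surjective
    (LinearMap.exact_subtype_mkQ S)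

theorem LinearMap.length_ker_add_eq (f : M →ₗ[R] N) :
    Module.length R (ker f) + Module.length R N =
      Module.length R M + Module.length R (N ⧸ range f) := by
  rw [f.length_eq_ker_add_range, (range f).length_eq_add_quotient, add_assoc]

/-- The map `M / fᵏM → M / fᵏ⁺¹M` induced by an endomorphism `f`. -/
def Module.End.quotRangePow (f : Module.End R M) (k : ℕ) :
    (M ⧸ LinearMap.range (f ^ k)) →ₗ[R] (M ⧸ LinearMap.range (f ^ (k + 1))) :=
  Submodule.mapQ _ _ f (by
    rintro _ ⟨x, rfl⟩
    exact ⟨x, by rw [pow_succ']; rfl⟩)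

/-- The projection from `M` onto the cokernel kills `f M`. -/
theorem Module.End.length_quotient_range_quotRangePow_le (f : Module.End R M) (k : ℕ) :
    Module.length R ((M ⧸ LinearMap.range (f ^ (k + 1))) ⧸ LinearMap.range (f.quotRangePow k)) ≤
      Module.length R (M ⧸ LinearMap.range f) := by
  let g : (M ⧸ LinearMap.range f) →ₗ[R]
      ((M ⧸ LinearMap.range (f ^ (k + 1))) ⧸ LinearMap.range (f.quotRangePow k)) :=
    Submodule.liftQ _ ((Submodule.mkQ _).comp (Submodule.mkQ _)) (by
      rintro _ ⟨x, rfl⟩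
      exact (Submodule.Quotient.mk_eq_zero _).2 ⟨Submodule.Quotient.mk x, rfl⟩)
  refine Module.length_le_of_surjective g fun y ↦ ?_
  obtain ⟨y, rfl⟩ := Submodule.mkQ_surjective _ y
  obtain ⟨y, rfl⟩ := Submodule.mkQ_surjective _ y
  exact ⟨Submodule.Quotient.mk y, rfl⟩

theorem Module.End.length_quotient_range_pow_ne_top (f : Module.End R M)
    (hf : Module.length R (M ⧸ LinearMap.range f) ≠ ⊤) (k : ℕ) :
    Module.length R (M ⧸ LinearMap.range (f ^ k)) ≠ ⊤ := by
  induction k with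
  | zero =>
    have : Subsingleton (M ⧸ LinearMap.range (f ^ 0)) :=
      Submodule.Quotient.subsingleton_iff.2 (by rw [pow_zero]; exact LinearMap.range_id)
    simp
  | succ k ih =>
    refine ne_top_of_le_ne_top (WithTop.add_ne_top.2 ⟨ih, hf⟩) ?_
    calc _ ≤ _ := le_add_self
      _ = _ := (f.quotRangePow k).length_ker_add_eq
      _ ≤ _ := add_le_add le_rfl (f.length_quotient_range_quotRangePow_le k)

/-- For an endomorphism of a Noetherian module, the kernel is at most as long as the cokernel. -/
theorem Module.End.length_ker_le_length_quotient_range [IsNoetherian R M] (f : Module.End R M) :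
    Module.length R (LinearMap.ker f) ≤ Module.length R (M ⧸ LinearMap.range f) := by
  by_cases hf : Module.length R (M ⧸ LinearMap.range f) = ⊤
  · rw [hf]; exact le_top
  -- For large `k` the kernel of `f` meets `fᵏM` trivially, so it embeds in `M / fᵏM`, inside the
  -- kernel of `f.quotRangePow k`. The bound `1 ≤ k` gives `ker f ≤ ker (f ^ k)`.
  obtain ⟨k, hk, hk1⟩ := (f.eventually_disjoint_ker_pow_range_pow.and
    (Filter.eventually_ge_atTop 1)).exists
  have hker : LinearMap.ker f ≤ LinearMap.ker (f ^ k) := fun x hx ↦ by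
    obtain ⟨j, rfl⟩ := Nat.exists_eq_add_of_le' hk1
    rw [LinearMap.mem_ker, pow_succ, Module.End.mul_apply, LinearMap.mem_ker.1 hx, map_zero]
  let g : LinearMap.ker f →ₗ[R] LinearMap.ker (f.quotRangePow k) :=
    LinearMap.codRestrict _ ((Submodule.mkQ _).comp (Submodule.subtype _)) (fun x ↦ by
      rw [LinearMap.mem_ker]
      change Submodule.Quotient.mk (f x) = 0
      rw [LinearMap.mem_ker.1 x.2]; rfl)
  have hg : Function.Injective g := by
    refine (injective_iff_map_eq_zero g).2 fun x hx ↦ ?_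
    have h1 : (x : M) ∈ LinearMap.range (f ^ k) :=
      (Submodule.Quotient.mk_eq_zero _).1 (congrArg Subtype.val hx)
    exact Subtype.ext ((Submodule.mem_bot R).1 (hk.le_bot ⟨hker x.2, h1⟩))
  have hle : Module.length R (M ⧸ LinearMap.range (f ^ k)) ≤
      Module.length R (M ⧸ LinearMap.range (f ^ (k + 1))) := by
    refine Module.length_le_of_surjective (Submodule.factor ?_) (Submodule.factor_surjective _)
    rintro _ ⟨x, rfl⟩
    exact ⟨f x, by rw [pow_succ]; rfl⟩
  have htop := f.length_quotient_range_pow_ne_top hf (k + 1)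
  refine (ENat.add_le_add_iff_right htop).1 ?_
  calc _ ≤ _ := add_le_add_left (Module.length_le_of_injective g hg) _
    _ = _ := (f.quotRangePow k).length_ker_add_eq
    _ ≤ _ := add_le_add hle (f.length_quotient_range_quotRangePow_le k)
    _ = _ := add_comm _ _

theorem exact_lsmul_mkQ (x : R) :
    Exact (LinearMap.lsmul R M x) (x • (⊤ : Submodule R M)).mkQ := by
  rw [LinearMap.exact_iff, Submodule.ker_mkQ]
  ext y
  simp [Submodule.mem_smul_pointwise_iff_exists]

theorem length_quotSMulTop_le_of_exact [IsNoetherian R P] (f : N →ₗ[R] M) (g : M →ₗ[R] P)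
    (hf : Injective f) (hg : Surjective g) (hfg : Exact f g) (x : R) :
    Module.length R (QuotSMulTop x N) ≤ Module.length R (QuotSMulTop x M) := by
  let δ := SnakeLemma.δ' (LinearMap.lsmul R N x) (LinearMap.lsmul R M x) (LinearMap.lsmul R P x)
    f g hfg f g hfg (by ext; simp) (by ext; simp) (LinearMap.ker (LinearMap.lsmul R P x)).subtype
    (LinearMap.exact_subtype_ker_map _) (x • (⊤ : Submodule R N)).mkQ (exact_lsmul_mkQ x) hg hf
  have hδ : Exact δ (QuotSMulTop.map x f) :=
    SnakeLemma.exact_δ'_left (LinearMap.lsmul R N x) (LinearMap.lsmul R M x)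
      (LinearMap.lsmul R P x)
      f g hfg f g hfg (by ext; simp) (by ext; simp) (LinearMap.ker (LinearMap.lsmul R P x)).subtype
      (LinearMap.exact_subtype_ker_map _) (x • (⊤ : Submodule R N)).mkQ (exact_lsmul_mkQ x)
      (x • (⊤ : Submodule R M)).mkQ (exact_lsmul_mkQ x) hg hf _ rfl (Submodule.mkQ_surjective _)
  have hP : LinearMap.range (LinearMap.lsmul R P x) = x • (⊤ : Submodule R P) := by
    rw [← (exact_lsmul_mkQ x).linearMap_ker_eq, Submodule.ker_mkQ]
  have hfg' := QuotSMulTop.map_exact x hfg hg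
  calc
    _ = Module.length R (LinearMap.ker (QuotSMulTop.map x f)) +
          Module.length R (LinearMap.range (QuotSMulTop.map x f)) :=
        (QuotSMulTop.map x f).length_eq_ker_add_range
    _ ≤ Module.length R (QuotSMulTop x P) +
          Module.length R (LinearMap.range (QuotSMulTop.map x f)) := by
        gcongr
        rw [hδ.linearMap_ker_eq]
        refine (Module.length_le_of_surjective _ δ.surjective_rangeRestrict).trans ?_
        refine (Module.End.length_ker_le_length_quotient_range _).trans ?_
        rw [hP]
    _ = Module.length R (QuotSMulTop x M) := by
        rw [(QuotSMulTop.map x g).length_eq_ker_add_range, hfg'.linearMap_ker_eq,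
          LinearMap.range_eq_top.2 (QuotSMulTop.map_surjective x hg), Module.length_top, add_comm]

end Length

/-! ### Regular elements and prime avoidance. -/

section Regular

variable {R : Type*} [CommRing R] {M : Type*} [AddCommGroup M] [Module R M]

/-- Prime avoidance: an ideal contains an `M`-regular element unless it is contained in an
associated prime of `M`. -/
theorem Ideal.exists_mem_isSMulRegular_or_exists_le_associatedPrime [IsNoetherianRing R]
    [Module.Finite R M] (I : Ideal R) :
    (∃ x ∈ I, IsSMulRegular M x) ∨ ∃ p ∈ associatedPrimes R M, I ≤ p := by
  by_contra! h
  have hM : Nontrivial M := by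
    by_contra hM
    rw [not_nontrivial_iff_subsingleton] at hM
    exact h.1 0 I.zero_mem fun _ _ _ ↦ Subsingleton.elim _ _
  have hsub : (I : Set R) ⊆ ⋃ p ∈ associatedPrimes R M, p := by
    rw [biUnion_associatedPrimes_eq_compl_regular]
    exact fun x hx ↦ h.1 x hx
  obtain ⟨p, hp, hle⟩ := (Ideal.subset_union_prime_finite (associatedPrimes.finite R M) (f := id)
    ⊥ ⊥ fun p hp _ _ ↦ hp.isPrime).1 hsub
  exact h.2 p hp hle

theorem IsSMulRegular.eq_zero_of_forall_mem_smul_eq_zero {I : Ideal R} {x : R}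
    (hx : IsSMulRegular M x) (hxI : x ∈ I) (c : M) (hc : ∀ r ∈ I, r • c = 0) : c = 0 :=
  hx (by simpa using hc x hxI)

/-- If `x` and `y` are `M`-regular elements of `I` and no nonzero element of `M / xM` is killed
by `I`, then the same holds for `M / yM`. -/
theorem QuotSMulTop.eq_zero_of_forall_mem_smul_eq_zero {I : Ideal R} {x y : R}
    (hxI : x ∈ I) (hx : IsSMulRegular M x) (hy : IsSMulRegular M y)
    (h : ∀ c : QuotSMulTop x M, (∀ r ∈ I, r • c = 0) → c = 0)
    (c : QuotSMulTop y M) (hc : ∀ r ∈ I, r • c = 0) : c = 0 := by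
  obtain ⟨c, rfl⟩ := Submodule.Quotient.mk_surjective _ c
  have key (r : R) (hr : r ∈ I) : ∃ e : M, y • e = r • c := by
    have := hc r hr
    rw [← Submodule.Quotient.mk_smul, Submodule.Quotient.mk_eq_zero,
      Submodule.mem_smul_pointwise_iff_exists] at this
    simpa using this
  -- From `y • e = x • c`, the class of `e` modulo `x` is killed by `I`; hence `e = x • u`, and
  -- cancelling `x` gives `c = y • u`.
  obtain ⟨e, he⟩ := key x hxI
  have he0 : (Submodule.Quotient.mk e : QuotSMulTop x M) = 0 := by
    refine h _ fun r hr ↦ ?_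
    obtain ⟨u, hu⟩ := key r hr
    rw [← Submodule.Quotient.mk_smul, Submodule.Quotient.mk_eq_zero,
      Submodule.mem_smul_pointwise_iff_exists]
    refine ⟨u, trivial, hy ?_⟩
    change y • x • u = y • r • e
    rw [smul_comm y x, hu, smul_comm y r, he, smul_comm x r]
  rw [Submodule.Quotient.mk_eq_zero, Submodule.mem_smul_pointwise_iff_exists] at he0 ⊢
  obtain ⟨u, -, hu⟩ := he0
  refine ⟨u, trivial, hx ?_⟩
  change x • y • u = x • c
  rw [← he, ← hu, smul_comm]

theorem IsSMulRegular.prod {N : Type*} [AddCommGroup N] [Module R N] {x : R} :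
    IsSMulRegular (M × N) x ↔ IsSMulRegular M x ∧ IsSMulRegular N x := by
  simp_rw [isSMulRegular_iff_right_eq_zero_of_smul]
  refine ⟨fun h ↦ ⟨fun m hm ↦ ?_, fun n hn ↦ ?_⟩, fun h z hz ↦ ?_⟩
  · simpa using h (m, 0) (by simp [hm])
  · simpa using h (0, n) (by simp [hn])
  · exact Prod.ext (h.1 _ (congrArg Prod.fst hz)) (h.2 _ (congrArg Prod.snd hz))

end Regular

/-! ### Depth through weakly regular sequences. -/

section Depth

variable {R : Type*} [CommRing R] [IsLocalRing R] {M : Type*} [AddCommGroup M] [Module R M]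

variable (R M) in
/-- There is a weakly `M`-regular sequence of length `n` in the maximal ideal. -/
def HasWeaklyRegularSeq (n : ℕ) : Prop :=
  ∃ rs : List R, rs.length = n ∧ (∀ r ∈ rs, r ∈ maximalIdeal R) ∧ IsWeaklyRegular M rs

theorem hasWeaklyRegularSeq_succ_iff {n : ℕ} :
    HasWeaklyRegularSeq R M (n + 1) ↔ ∃ r ∈ maximalIdeal R, IsSMulRegular M r ∧
      HasWeaklyRegularSeq R (QuotSMulTop r M) n := by
  constructor
  · rintro ⟨rs, hlen, hmem, hreg⟩
    match rs with
    | [] => simp at hlen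
    | r :: rs =>
      rw [isWeaklyRegular_cons_iff] at hreg
      exact ⟨r, hmem r (by simp), hreg.1, rs, by simpa using hlen,
        fun s hs ↦ hmem s (by simp [hs]), hreg.2⟩
  · rintro ⟨r, hr, hreg, rs, rfl, hmem, hrs⟩
    exact ⟨r :: rs, rfl, by simpa using ⟨hr, hmem⟩, IsWeaklyRegular.cons hreg hrs⟩

theorem hasWeaklyRegularSeq_of_le_moduleDepth {n : ℕ} [Module.Finite R M]
    (h : (n : ℕ∞) ≤ moduleDepth R M) : HasWeaklyRegularSeq R M n := by
  rw [moduleDepth] at h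
  split_ifs at h with htop
  -- Infinite depth means `M = 0` by Nakayama, and there a sequence of zeros is weakly regular.
  · have : Subsingleton M := by
      by_contra hM
      rw [not_subsingleton_iff_nontrivial] at hM
      exact Submodule.top_ne_ideal_smul_of_le_jacobson_annihilator
        (maximalIdeal_le_jacobson _) htop.symm
    refine ⟨List.replicate n 0, by simp, fun r hr ↦ ?_, ?_⟩
    · rw [List.eq_of_mem_replicate hr]; exact zero_mem _
    · clear h htop
      induction n generalizing M with
      | zero => exact IsWeaklyRegular.nil R M
      | succ n ih =>
        exact IsWeaklyRegular.cons (fun _ _ _ ↦ Subsingleton.elim _ _) (ih inferInstance)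
  · obtain _ | n := n
    · exact ⟨[], rfl, by simp, IsWeaklyRegular.nil R M⟩
    obtain ⟨⟨rs, hmem, hreg⟩, hlt⟩ := lt_iSup_iff.1 <|
      lt_of_lt_of_le (Nat.cast_lt.2 n.lt_succ_self) h
    have hlen : n + 1 ≤ rs.length := Nat.cast_lt.1 hlt
    refine ⟨rs.take (n + 1), by simpa using hlen, fun r hr ↦ hmem r (List.mem_of_mem_take hr), ?_⟩
    have := hreg.toIsWeaklyRegular
    rw [← List.take_append_drop (n + 1) rs, isWeaklyRegular_append_iff] at this
    exact this.1

/-- A module with zero socle has a regular element in the maximal ideal. -/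
theorem IsLocalRing.exists_mem_maximalIdeal_isSMulRegular_of_socle [IsNoetherianRing R]
    [Module.Finite R M] (h : ∀ c : M, (∀ r ∈ maximalIdeal R, r • c = 0) → c = 0) :
    ∃ x ∈ maximalIdeal R, IsSMulRegular M x := by
  refine (maximalIdeal R).exists_mem_isSMulRegular_or_exists_le_associatedPrime.resolve_right ?_
  rintro ⟨p, hp, hle⟩
  obtain ⟨hprime, c, rfl⟩ := isAssociatedPrime_iff.1 hp
  have hc := h c fun r hr ↦ by simpa [Submodule.mem_colon_singleton] using hle hr
  exact hprime.ne_top (by simp [hc])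

/-- Passing to the quotient by a regular element lowers the depth by at most one. -/
theorem HasWeaklyRegularSeq.quotSMulTop [IsNoetherianRing R] [Module.Finite R M] {n : ℕ}
    (h : HasWeaklyRegularSeq R M (n + 1)) {y : R} (hy : y ∈ maximalIdeal R)
    (hyM : IsSMulRegular M y) : HasWeaklyRegularSeq R (QuotSMulTop y M) n := by
  induction n generalizing M y with
  | zero => exact ⟨[], rfl, by simp, IsWeaklyRegular.nil R _⟩
  | succ n ih =>
    obtain ⟨x, hx, hxM, hX⟩ := hasWeaklyRegularSeq_succ_iff.1 h
    obtain ⟨w, hw, hwX, -⟩ := hasWeaklyRegularSeq_succ_iff.1 hX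
    have hsocX := hwX.eq_zero_of_forall_mem_smul_eq_zero hw
    have hsocY := QuotSMulTop.eq_zero_of_forall_mem_smul_eq_zero hx hxM hyM hsocX
    -- Regularity on the product gives one `z` regular modulo both `x` and `y`. It links the two:
    -- swapping `x, z` moves the long sequence to `M / zM`, induction there divides out `y`, and
    -- swapping `z, y` returns to `M / yM`.
    obtain ⟨z, hz, hzreg⟩ := exists_mem_maximalIdeal_isSMulRegular_of_socle
      (M := QuotSMulTop x M × QuotSMulTop y M) fun c hc ↦
        Prod.ext (hsocX _ fun r hr ↦ congrArg Prod.fst (hc r hr))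
          (hsocY _ fun r hr ↦ congrArg Prod.snd (hc r hr))
    obtain ⟨hzX, hzY⟩ := IsSMulRegular.prod.1 hzreg
    have swap {a b : R} {rs : List R} (hab : IsWeaklyRegular M (a :: b :: rs))
        (ha : a ∈ maximalIdeal R) (hb : b ∈ maximalIdeal R)
        (hrs : ∀ r ∈ rs, r ∈ maximalIdeal R) : IsWeaklyRegular M (b :: a :: rs) :=
      isWeaklyRegular_of_perm_of_subset_maximalIdeal hab (List.Perm.swap _ _ _)
        (by simpa using ⟨ha, hb, hrs⟩)
    obtain ⟨ts, hts, htmem, htreg⟩ := ih hX hz hzX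
    have hzx := swap (IsWeaklyRegular.cons hxM (IsWeaklyRegular.cons hzX htreg)) hx hz htmem
    have hzy := swap (IsWeaklyRegular.cons hyM (IsWeaklyRegular.cons hzY
      (IsWeaklyRegular.nil R _))) hy hz (rs := []) (by simp)
    simp only [isWeaklyRegular_cons_iff _ z] at hzx hzy
    have hZ : HasWeaklyRegularSeq R (QuotSMulTop z M) (n + 1) :=
      ⟨x :: ts, by simp [hts], by simpa using ⟨hx, htmem⟩, hzx.2⟩
    obtain ⟨us, hus, humem, hureg⟩ := ih hZ hy
      ((isWeaklyRegular_cons_iff _ _ _).1 hzy.2).1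
    have := swap (IsWeaklyRegular.cons hzx.1 (IsWeaklyRegular.cons
      ((isWeaklyRegular_cons_iff _ _ _).1 hzy.2).1 hureg)) hz hy humem
    exact ⟨z :: us, by simp [hus], by simpa using ⟨hz, humem⟩,
      ((isWeaklyRegular_cons_iff _ _ _).1 this).2⟩

end Depth

/-! ### Choice of a generator and the induction. -/

section Main

/-- The prime `p` lies in the support of `M / qM`, which a power of the maximal ideal kills by the
descending chain condition and Nakayama. -/
theorem IsLocalRing.le_of_isFiniteLength_quotient {R : Type*} [CommRing R] [IsLocalRing R]
    {M : Type*} [AddCommGroup M] [Module R M] [Module.Finite R M] {q : Ideal R}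
    (hfin : IsFiniteLength R (M ⧸ (q • ⊤ : Submodule R M))) {p : Ideal R} [p.IsPrime]
    (hann : Module.annihilator R M ≤ p) (hq : q ≤ p) : maximalIdeal R ≤ p := by
  obtain ⟨_, _⟩ := isFiniteLength_iff_isNoetherian_isArtinian.1 hfin
  have hp : (⟨p, inferInstance⟩ : PrimeSpectrum R) ∈
      Module.support R (M ⧸ (q • ⊤ : Submodule R M)) := by
    rw [Module.support_quotient]
    exact ⟨Module.mem_support_iff_of_finite.2 hann, hq⟩
  rw [Module.mem_support_iff_of_finite] at hp
  let X := M ⧸ (q • ⊤ : Submodule R M)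
  obtain ⟨k, hk⟩ := IsArtinian.monotone_stabilizes (R := R) (M := X)
    ⟨fun k ↦ OrderDual.toDual (maximalIdeal R ^ k • (⊤ : Submodule R X)),
      fun i j hij ↦ Submodule.smul_mono_left (Ideal.pow_le_pow_right hij)⟩
  have hk : maximalIdeal R ^ k • (⊤ : Submodule R X) =
      maximalIdeal R ^ (k + 1) • (⊤ : Submodule R X) := hk (k + 1) k.le_succ
  have hzero : maximalIdeal R ^ k • (⊤ : Submodule R X) = ⊥ := by
    refine Submodule.eq_bot_of_le_smul_of_le_jacobson_bot (maximalIdeal R) _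
      (IsNoetherian.noetherian _) ?_ (maximalIdeal_le_jacobson _)
    rw [← mul_smul, ← pow_succ', ← hk]
  refine Ideal.IsPrime.le_of_pow_le (n := k) (le_trans (fun r hr ↦ ?_) hp)
  rw [Module.mem_annihilator]
  intro m
  rw [← Submodule.mem_bot R, ← hzero]
  exact Submodule.smul_mem_smul hr trivial

/-- An ideal `q` with `M / qM` of finite length contains an `M`-regular element which is a minimal
generator of `q`, provided that the maximal ideal contains an `M`-regular element. -/
theorem IsLocalRing.exists_mem_notMem_maximalIdeal_mul_isSMulRegular {R : Type*} [CommRing R]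
    [IsNoetherianRing R] [IsLocalRing R] {M : Type*} [AddCommGroup M] [Module R M]
    [Module.Finite R M] [Nontrivial M] {q : Ideal R}
    (hfin : IsFiniteLength R (M ⧸ (q • ⊤ : Submodule R M)))
    (hreg : ∃ w ∈ maximalIdeal R, IsSMulRegular M w) :
    ∃ y ∈ q, y ∉ maximalIdeal R * q ∧ IsSMulRegular M y := by
  have hass (p : Ideal R) (hp : p ∈ associatedPrimes R M) : ¬ q ≤ p := fun hq ↦ by
    have := hp.isPrime
    obtain ⟨w, hw, hwreg⟩ := hreg
    have hwp := le_of_isFiniteLength_quotient hfin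
      (Submodule.annihilator_top (R := R) (M := M) ▸ hp.annihilator_le) hq hw
    have hmem : w ∈ ⋃ p ∈ associatedPrimes R M, (p : Set R) := Set.mem_biUnion hp hwp
    rw [biUnion_associatedPrimes_eq_compl_regular] at hmem
    exact hmem hwreg
  by_contra! h
  -- Prime avoidance tolerates the one possibly non-prime ideal `maximalIdeal R * q`.
  have hsub : (q : Set R) ⊆
      ⋃ p ∈ insert (maximalIdeal R * q) (associatedPrimes R M), (p : Set R) := by
    intro y hy
    rw [Set.biUnion_insert, biUnion_associatedPrimes_eq_compl_regular]
    exact or_iff_not_imp_left.2 fun hy' ↦ h y hy hy'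
  obtain ⟨p, rfl | hp, hle⟩ := (Ideal.subset_union_prime_finite
    ((associatedPrimes.finite R M).insert (maximalIdeal R * q)) (f := id) (maximalIdeal R * q)
    (maximalIdeal R * q) fun p hp hne _ ↦ (hp.resolve_left hne).isPrime).1 hsub
  · have hbot : q = ⊥ := Submodule.eq_bot_of_le_smul_of_le_jacobson_bot (maximalIdeal R) q
      (IsNoetherian.noetherian _) hle (maximalIdeal_le_jacobson _)
    obtain ⟨p, hp⟩ := associatedPrimes.nonempty R M
    exact hass p hp (hbot ▸ bot_le)
  · exact hass p hp hle

/-- Some coefficient of `y` in the `x i` is a unit, so `y` can replace that generator. -/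
theorem IsLocalRing.exists_span_singleton_sup_span_range_eq {R : Type*} [CommRing R]
    [IsLocalRing R] {n : ℕ} (x : Fin (n + 1) → R) {y : R} (hy : y ∈ Ideal.span (Set.range x))
    (hy' : y ∉ maximalIdeal R * Ideal.span (Set.range x)) :
    ∃ x' : Fin n → R, Ideal.span (Set.range x) = Ideal.span {y} ⊔ Ideal.span (Set.range x') := by
  obtain ⟨a, ha⟩ := Ideal.mem_span_range_iff_exists_fun.1 hy
  obtain ⟨i, hi⟩ : ∃ i, IsUnit (a i) := by
    by_contra! h
    refine hy' (ha ▸ Ideal.sum_mem _ fun i _ ↦ Ideal.mul_mem_mul ?_ ?_)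
    · exact (mem_maximalIdeal _).2 (h i)
    · exact Ideal.subset_span ⟨i, rfl⟩
  refine ⟨x ∘ i.succAbove, le_antisymm ?_ (sup_le ?_ ?_)⟩
  · have hx (j : Fin n) : x (i.succAbove j) ∈
        Ideal.span {y} ⊔ Ideal.span (Set.range (x ∘ i.succAbove)) :=
      Ideal.mem_sup_right (Ideal.subset_span ⟨j, rfl⟩)
    rw [Ideal.span_le]
    rintro _ ⟨j, rfl⟩
    obtain rfl | ⟨j, rfl⟩ := i.eq_self_or_eq_succAbove j
    · rw [Fin.sum_univ_succAbove _ j] at ha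
      refine (Ideal.unit_mul_mem_iff_mem _ hi).1 ?_
      rw [eq_sub_of_add_eq ha]
      exact Ideal.sub_mem _ (Ideal.mem_sup_left (Ideal.mem_span_singleton_self y))
        (Ideal.sum_mem _ fun k _ ↦ Ideal.mul_mem_left _ _ (hx k))
    · exact hx j
  · exact (Ideal.span_singleton_le_iff_mem _).2 hy
  · exact Ideal.span_mono (Set.range_comp_subset_range _ _)

theorem QuotSMulTop.length_quotient_smul_top {R : Type*} [CommRing R] (M : Type*)
    [AddCommGroup M] [Module R M] (y : R) (J : Ideal R) :
    Module.length R (QuotSMulTop y M ⧸ (J • ⊤ : Submodule R (QuotSMulTop y M))) =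
      Module.length R (M ⧸ ((Ideal.span {y} ⊔ J) • ⊤ : Submodule R M)) :=
  LinearEquiv.length_eq <|
    Submodule.quotEquivOfEq _ _ (by rw [Submodule.map_smul'', Submodule.map_top,
      Submodule.range_mkQ]) ≪≫ₗ
    Submodule.quotientQuotientEquivQuotientSup (y • ⊤) (J • ⊤) ≪≫ₗ
    Submodule.quotEquivOfEq _ _ (by rw [Submodule.sup_smul, Submodule.ideal_span_singleton_smul])

theorem length_quotient_smul_top_le_of_exact {R : Type*} [CommRing R] [IsNoetherianRing R]
    [IsLocalRing R] {N M P : Type*} [AddCommGroup N] [AddCommGroup M] [AddCommGroup P]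
    [Module R N] [Module R M] [Module R P] [Module.Finite R P]
    (f : N →ₗ[R] M) (g : M →ₗ[R] P) (hf : Injective f) (hg : Surjective g) (hfg : Exact f g)
    {n : ℕ} (x : Fin (n + 1) → R) (hx : ∀ i, x i ∈ maximalIdeal R)
    (hP : HasWeaklyRegularSeq R P n) :
    Module.length R (N ⧸ (Ideal.span (Set.range x) • ⊤ : Submodule R N)) ≤
      Module.length R (M ⧸ (Ideal.span (Set.range x) • ⊤ : Submodule R M)) := by
  induction n generalizing N M P with
  | zero =>
    have hrange : Set.range x = {x 0} := Set.range_unique (ι := Fin 1)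
    rw [hrange, Submodule.ideal_span_singleton_smul, Submodule.ideal_span_singleton_smul]
    exact length_quotSMulTop_le_of_exact f g hf hg hfg _
  | succ n ih =>
    -- Disposing of infinite length here spares the induction a finiteness hypothesis.
    by_cases htop : Module.length R (M ⧸ (Ideal.span (Set.range x) • ⊤ : Submodule R M)) = ⊤
    · rw [htop]; exact le_top
    obtain hP' | hP' := subsingleton_or_nontrivial P
    · have hfs : Surjective f := fun m ↦ (hfg m).1 (Subsingleton.elim _ _)
      let e := LinearEquiv.ofBijective f ⟨hf, hfs⟩
      refine (LinearEquiv.length_eq (Submodule.Quotient.equiv _ _ e ?_)).le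
      rw [Submodule.map_smul'', Submodule.map_top]
      exact congrArg _ (LinearEquiv.range e)
    have hfin : IsFiniteLength R (P ⧸ (Ideal.span (Set.range x) • ⊤ : Submodule R P)) := by
      rw [← Module.length_ne_top_iff]
      refine ne_top_of_le_ne_top htop (Module.length_le_of_surjective (Submodule.mapQ _ _ g
        (Submodule.smul_top_le_comap_smul_top _ g)) ?_)
      rw [← LinearMap.range_eq_top, Submodule.range_mapQ, LinearMap.range_eq_top.2 hg,
        Submodule.map_top, Submodule.range_mkQ]
    obtain ⟨w, hw, hwreg, -⟩ := hasWeaklyRegularSeq_succ_iff.1 hP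
    obtain ⟨y, hy, hy', hyP⟩ :=
      exists_mem_notMem_maximalIdeal_mul_isSMulRegular hfin ⟨w, hw, hwreg⟩
    have hq : Ideal.span (Set.range x) ≤ maximalIdeal R :=
      Ideal.span_le.2 (by rintro _ ⟨i, rfl⟩; exact hx i)
    obtain ⟨x', hx'⟩ := exists_span_singleton_sup_span_range_eq x hy hy'
    rw [hx', ← QuotSMulTop.length_quotient_smul_top, ← QuotSMulTop.length_quotient_smul_top]
    -- Regularity of `y` on `P` is what preserves injectivity on the left.
    have hinj : Injective (QuotSMulTop.map y f) := by
      have h0 : Exact (0 : N →ₗ[R] N) f := by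
        rw [LinearMap.exact_iff, LinearMap.range_zero, LinearMap.ker_eq_bot.2 hf]
      have := QuotSMulTop.map_first_exact_on_four_term_exact_of_isSMulRegular_last h0 hfg hyP
      rw [LinearMap.exact_iff, map_zero, LinearMap.range_zero] at this
      exact LinearMap.ker_eq_bot.1 this
    exact ih (QuotSMulTop.map y f) (QuotSMulTop.map y g) hinj (QuotSMulTop.map_surjective y hg)
      (QuotSMulTop.map_exact y hfg hg) x'
      (fun i ↦ hq (hx' ▸ Ideal.mem_sup_right (Ideal.subset_span ⟨i, rfl⟩)))
      (hP.quotSMulTop (hq hy) hyP)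

end Main

theorem theorem3 {R : Type*} [CommRing R] [IsNoetherianRing R] [IsLocalRing R]
    {M : Type*} [AddCommGroup M] [Module R M] [Module.Finite R M]
    (d : ℕ) (hd : 1 ≤ d) (hM : Module.supportDim R M = d)
    (N : Submodule R M) (hN : ((d - 1 : ℕ) : ℕ∞) ≤ moduleDepth R (M ⧸ N))
    (q : Ideal R) (hq : ∃ x : Fin d → R, IsSystemOfParameters M x ∧ q = Ideal.span (Set.range x)) :
    Module.length R (N ⧸ (q • ⊤ : Submodule R N)) ≤
      Module.length R (M ⧸ (q • ⊤ : Submodule R M)) := by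
  obtain ⟨x, hx, rfl⟩ := hq
  obtain ⟨n, rfl⟩ := Nat.exists_eq_add_of_le' hd
  exact length_quotient_smul_top_le_of_exact N.subtype N.mkQ N.subtype_injective N.mkQ_surjective
    (LinearMap.exact_subtype_mkQ N) x hx.mem_maximalIdeal
    (hasWeaklyRegularSeq_of_le_moduleDepth hN)
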